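/- Let $(\Omega,\mathcal F,P)$ be a probability space, let $(\varepsilon_i)_{i\ge 1}$ be independent, square-integrable real random variables with $E(\varepsilon_i)=0$ and $E(\varepsilon_i^2)=1$ for all $i\ge 1$, and let $b=(b_i)_{i\ge1}\in\ell_2$. Assume that $P(\varepsilon_i>b_i)>0$ and $P(\varepsilon_i<b_i)>0$ for all $i\ge1$, and that $\sup_{i\ge1}E(|\varepsilon_i|^3)<\infty$. For $h\in\ell_2$ let $\langle h,\varepsilon-b\rangle:=\sum_{i=1}^{\infty}h_i(\varepsilon_i-b_i)$, where the sum is the limit in $L^2(P)$ of the partial sums (which exists). For $x\in\mathbb R$ put $$K^x:=\{x+\langle h,\varepsilon-b\rangle:\ h\in\ell_2\},\qquad C^x:=K^x-L^2_+(P)=\{V-\kappa:\ V\in K^x,\ \kappa\in L^2(P),\ \kappa\ge 0\ \text{a.s.}\}.$$ Let $z\in\mathbb R$ and let $B\in L^2(P)$ be such that $B\notin C^z$. Then there exists $\eta>0$ such that $$\inf_{h\in\ell_2}P\bigl(z+\langle h,\varepsilon-b\rangle<B-\eta\bigr)>\eta .$$ -/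

import Mathlib

open MeasureTheory ProbabilityTheory Filter Topology

namespace LargeMarket

/-- The Hilbert space of square-summable real sequences. The assets with a risky return, numbered
`1, 2, 3, …` in the mathematical text, are numbered `0, 1, 2, …` here. -/
abbrev EllTwo : Type := lp (fun _ : ℕ => ℝ) 2

noncomputable section

variable {Ω : Type*} [MeasurableSpace Ω] (P : Measure Ω) [IsProbabilityMeasure P]

/-- The gain `∑_{i < n} h i * (ε i - b i)`, as an element of `L²(P)`, of the strategy that follows
`h` in the first `n` risky assets. -/
def finiteGain {ε : ℕ → Ω → ℝ} (hε : ∀ i, MemLp (ε i) 2 P) (b h : ℕ → ℝ) (n : ℕ) : Lp ℝ 2 P :=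
  ∑ i ∈ Finset.range n, h i • ((hε i).toLp (ε i) - Lp.const 2 P (b i))

/-- The gain `⟨h, ε - b⟩ = ∑_i h i * (ε i - b i)`: the limit in `L²(P)` of the partial sums.
The limit exists for independent standardized `ε i` and square-summable `b`, see `tendsto_gain`. -/
def gain {ε : ℕ → Ω → ℝ} (hε : ∀ i, MemLp (ε i) 2 P) (b : ℕ → ℝ) (h : EllTwo) : Lp ℝ 2 P :=
  limUnder atTop (finiteGain P hε b h)

/-- The portfolio value `V^{x,h} = x + ⟨h, ε - b⟩`. -/
def portfolioValue {ε : ℕ → Ω → ℝ} (hε : ∀ i, MemLp (ε i) 2 P) (b : ℕ → ℝ) (x : ℝ)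
    (h : EllTwo) : Lp ℝ 2 P :=
  Lp.const 2 P x + gain P hε b h

/-- The set `K^x` of the portfolio values that are attainable from the initial wealth `x`. -/
def attainable {ε : ℕ → Ω → ℝ} (hε : ∀ i, MemLp (ε i) 2 P) (b : ℕ → ℝ) (x : ℝ) :
    Set (Lp ℝ 2 P) :=
  Set.range (portfolioValue P hε b x)

/-- The set `C^x = K^x - L²₊(P)`: attainable wealth after possibly throwing away money. The order
on `L²(P)` is the almost sure one. -/
def attainableWithDisposal {ε : ℕ → Ω → ℝ} (hε : ∀ i, MemLp (ε i) 2 P) (b : ℕ → ℝ) (x : ℝ) :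
    Set (Lp ℝ 2 P) :=
  {X | ∃ V ∈ attainable P hε b x, ∃ κ : Lp ℝ 2 P, 0 ≤ κ ∧ X = V - κ}

/-- The limit that defines `gain` exists. -/
theorem tendsto_gain {ε : ℕ → Ω → ℝ} (hε : ∀ i, MemLp (ε i) 2 P) (hind : iIndepFun ε P)
    (hmean : ∀ i, ∫ ω, ε i ω ∂P = 0) (hvar : ∀ i, ∫ ω, ε i ω ^ 2 ∂P = 1)
    {b : ℕ → ℝ} (hb : Memℓp b 2) (h : EllTwo) :
    Tendsto (finiteGain P hε b h) atTop (𝓝 (gain P hε b h)) := by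
  have hon : Orthonormal ℝ (fun i => (hε i).toLp (ε i)) := by
    rw [orthonormal_iff_ite]
    intro i j
    have hinner : inner ℝ ((hε i).toLp (ε i)) ((hε j).toLp (ε j)) = ∫ ω, ε i ω * ε j ω ∂P := by
      rw [L2.inner_def]
      refine integral_congr_ae ?_
      filter_upwards [(hε i).coeFn_toLp, (hε j).coeFn_toLp] with ω h1 h2
      rw [h1, h2]
      simp [mul_comm]
    rw [hinner]
    split_ifs with hij
    · subst hij
      simpa [sq] using hvar i
    · rw [(hind.indepFun hij).integral_fun_mul_eq_mul_integral (hε i).1 (hε j).1, hmean i, zero_mul]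
  have h1 : Summable fun i => (h : ℕ → ℝ) i • (hε i).toLp (ε i) := by
    simpa using (hon.orthogonalFamily.hasSum_linearIsometry h).summable
  have h2 : Summable fun i => (h : ℕ → ℝ) i * b i := by
    have := lp.summable_inner (𝕜 := ℝ) h ⟨b, hb⟩
    simpa [mul_comm] using this
  have h3 : Summable fun i => (h : ℕ → ℝ) i • (Lp.const 2 P (b i) : Lp ℝ 2 P) := by
    have := (Lp.constL 2 P ℝ (E := ℝ)).summable h2
    refine this.congr fun i => ?_
    rw [← smul_eq_mul, map_smul]
    rfl
  have h4 := (h1.sub h3).hasSum.tendsto_sum_nat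
  refine tendsto_nhds_limUnder ⟨_, h4.congr fun n => ?_⟩
  simp only [finiteGain, smul_sub]

end

end LargeMarket

/-! Argue by contradiction: there are strategies `h n` whose gains `U (h n)` dominate `B - z - η n`
outside events of probability below `2 * η n`, with `η n → 0`. Along a free ultrafilter the norms
`‖h n‖` are either bounded or tend to infinity.

In the bounded case the `h n` have a weak limit `g`. Integrals of `U (h n) - (B - z - η n)` over any
event are asymptotically nonnegative, because Cauchy–Schwarz controls the negative part by the
square root of its probability. Hence `U g ≥ B - z` (`le_of_weak_limit`), so `B` lies in `C^z`.

In the unbounded case, divide by `‖h n‖`: unit vectors then dominate claims tending to zero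
(`not_tendsto_of_norm_eq_one`). Their weak limit has a nonnegative gain, so it vanishes by absence
of arbitrage (`eq_zero_of_gain_nonneg`), and the drift `⟨b, g n⟩` tends to zero. What remains is a
centred noise almost bounded below by a small variable, so its `L¹` norm tends to zero. The third
moments forbid this (`integral_abs_noise_ge`). -/

namespace LargeMarket

/-! ### Weak compactness -/

/-- A bounded family in a Hilbert space has a weak limit along every ultrafilter. -/
theorem exists_weak_limit {H ι : Type*} [NormedAddCommGroup H] [InnerProductSpace ℝ H]
    [CompleteSpace H] (F : Ultrafilter ι) (g : ι → H) {R : ℝ} (hg : ∀ᶠ i in F, ‖g i‖ ≤ R) :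
    ∃ g₀ : H, ∀ y, Tendsto (fun i => inner ℝ (g i) y) F (𝓝 (inner ℝ g₀ y)) := by
  -- The Riesz isometry moves the family into a dual ball, which is weak-* compact by
  -- Banach–Alaoglu.
  let T : ι → WeakDual ℝ H := fun i =>
    StrongDual.toWeakDual (InnerProductSpace.toDual ℝ H (g i))
  have hT : (F.map T : Filter (WeakDual ℝ H)) ≤
      𝓟 (WeakDual.toStrongDual ⁻¹' Metric.closedBall (0 : StrongDual ℝ H) R) := by
    rw [le_principal_iff, Ultrafilter.coe_map, mem_map]
    filter_upwards [hg] with i hi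
    simpa [T] using hi
  obtain ⟨f, -, hf⟩ := (WeakDual.isCompact_closedBall (𝕜 := ℝ) (0 : StrongDual ℝ H) R
    ).ultrafilter_le_nhds (F.map T) hT
  refine ⟨(InnerProductSpace.toDual ℝ H).symm (WeakDual.toStrongDual f), fun y => ?_⟩
  rw [InnerProductSpace.toDual_symm_apply]
  have h1 : Tendsto T F (𝓝 f) := hf
  exact ((WeakDual.eval_continuous y).tendsto f).comp h1

/-! ### Asymptotic domination in `L²` -/

section L2

variable {Ω : Type*} [MeasurableSpace Ω] (P : Measure Ω)

theorem measurableSet_lp_neg (X : Lp ℝ 2 P) : MeasurableSet {ω | X ω < 0} :=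
  measurableSet_lt (Lp.stronglyMeasurable X).measurable measurable_const

theorem measureReal_sub_neg (X Y : Lp ℝ 2 P) :
    P.real {ω | (X - Y : Lp ℝ 2 P) ω < 0} = P.real {ω | X ω < Y ω} := by
  refine measureReal_congr ?_
  filter_upwards [Lp.coeFn_sub X Y] with ω h
  refine propext ?_
  change (X - Y : Lp ℝ 2 P) ω < 0 ↔ X ω < Y ω
  rw [h, Pi.sub_apply, sub_neg]

variable [IsProbabilityMeasure P]

theorem norm_indicatorConstLp_one {A : Set Ω} (hA : MeasurableSet A) :
    ‖indicatorConstLp 2 hA (measure_ne_top P A) (1 : ℝ)‖ = √(P.real A) := by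
  rw [norm_indicatorConstLp (by norm_num) (by norm_num), Real.sqrt_eq_rpow]
  simp

theorem abs_setIntegral_le_norm (X : Lp ℝ 2 P) {A : Set Ω} (hA : MeasurableSet A) :
    |∫ ω in A, X ω ∂P| ≤ ‖X‖ * √(P.real A) := by
  rw [← L2.inner_indicatorConstLp_one (𝕜 := ℝ) hA (measure_ne_top P A) X, mul_comm,
    ← norm_indicatorConstLp_one P hA]
  exact abs_real_inner_le_norm _ _

theorem integrable_lp_two (X : Lp ℝ 2 P) : Integrable X P :=
  (Lp.memLp X).integrable (by norm_num)

/-- Among all events, `{X < 0}` minimizes the integral of `X`; Cauchy–Schwarz bounds that minimum.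
-/
theorem neg_le_setIntegral (X : Lp ℝ 2 P) {A : Set Ω} (hA : MeasurableSet A) :
    -(‖X‖ * √(P.real {ω | X ω < 0})) ≤ ∫ ω in A, X ω ∂P := by
  have hX := integrable_lp_two P X
  have hN := measurableSet_lp_neg P X
  have h1 := neg_le_of_abs_le (abs_setIntegral_le_norm P X hN)
  refine h1.trans ?_
  rw [← integral_indicator hN, ← integral_indicator hA]
  refine integral_mono (hX.indicator hN) (hX.indicator hA) fun ω => ?_
  by_cases h : X ω < 0 <;> by_cases h' : ω ∈ A <;> simp [Set.indicator, h, h'] <;> linarith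

/-- Integrate `|X| = X - 2 X 1_{X < 0}` and apply Cauchy–Schwarz to the last term. -/
theorem integral_abs_le (X : Lp ℝ 2 P) :
    ∫ ω, |X ω| ∂P ≤ ∫ ω, X ω ∂P + 2 * (‖X‖ * √(P.real {ω | X ω < 0})) := by
  have hX := integrable_lp_two P X
  have hN := measurableSet_lp_neg P X
  have h1 := neg_le_of_abs_le (abs_setIntegral_le_norm P X hN)
  have h2 : ∫ ω, |X ω| ∂P = ∫ ω, X ω ∂P - 2 * ∫ ω in {ω | X ω < 0}, X ω ∂P := by
    rw [← integral_indicator hN, ← integral_const_mul,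
      ← integral_sub hX ((hX.indicator hN).const_mul 2)]
    congr 1 with ω
    by_cases h : X ω < 0
    · simp [Set.indicator, h, abs_of_neg]; ring
    · simp [Set.indicator, h, abs_of_nonneg (not_lt.1 h)]
  linarith

/-- If the bounded family `U (g i)` dominates `B i` with probability tending to one, then the
weak limit dominates the limit of `B i`. -/
theorem le_of_weak_limit {H ι : Type*} [NormedAddCommGroup H] [InnerProductSpace ℝ H]
    [CompleteSpace H] {l : Filter ι} [l.NeBot] (U : H →L[ℝ] Lp ℝ 2 P) {g : ι → H} {R : ℝ}
    (hg : ∀ᶠ i in l, ‖g i‖ ≤ R) {g₀ : H}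
    (hw : ∀ y, Tendsto (fun i => inner ℝ (g i) y) l (𝓝 (inner ℝ g₀ y)))
    {B : ι → Lp ℝ 2 P} {B₀ : Lp ℝ 2 P} (hB : Tendsto B l (𝓝 B₀))
    (hP : Tendsto (fun i => P.real {ω | U (g i) ω < B i ω}) l (𝓝 0)) : B₀ ≤ U g₀ := by
  rw [← sub_nonneg, ← Lp.coeFn_nonneg]
  refine ae_nonneg_of_forall_setIntegral_nonneg (integrable_lp_two P _) fun A hA _ => ?_
  rw [← L2.inner_indicatorConstLp_one (𝕜 := ℝ) hA (measure_ne_top P A)]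
  set a := indicatorConstLp 2 hA (measure_ne_top P A) (1 : ℝ)
  have h1 : Tendsto (fun i => inner ℝ a (U (g i) - B i)) l (𝓝 (inner ℝ a (U g₀ - B₀))) := by
    simp only [inner_sub_right]
    refine Tendsto.sub ?_ (tendsto_const_nhds.inner hB)
    -- The adjoint makes `U` weakly continuous.
    have := hw (ContinuousLinearMap.adjoint U a)
    simp only [ContinuousLinearMap.adjoint_inner_right] at this
    simpa only [real_inner_comm] using this
  have h2 : Tendsto (fun i => -((‖U‖ * R + (‖B₀‖ + 1)) * √(P.real {ω | U (g i) ω < B i ω}))) l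
      (𝓝 0) := by
    have := (hP.sqrt.const_mul (‖U‖ * R + (‖B₀‖ + 1))).neg
    simpa using this
  refine le_of_tendsto_of_tendsto h2 h1 ?_
  have h3 : ∀ᶠ i in l, ‖B i‖ < ‖B₀‖ + 1 := hB.norm.eventually_lt_const (by linarith)
  filter_upwards [hg, h3] with i h4 h5
  rw [L2.inner_indicatorConstLp_one (𝕜 := ℝ) hA (measure_ne_top P A)]
  refine le_trans (neg_le_neg ?_) (neg_le_setIntegral P _ hA)
  rw [measureReal_sub_neg]
  gcongr
  refine (norm_sub_le _ _).trans (add_le_add ?_ h5.le)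
  exact (U.le_opNorm _).trans (by gcongr)

end L2

/-! ### Third moments of weighted sums -/

/-- Taylor expansion of `|·|³` at `s` to second order. The term linear in `x` drops out once `x` is
replaced by an independent centred variable. -/
theorem abs_add_pow_three_le (s x : ℝ) :
    |s + x| ^ 3 ≤ |s| ^ 3 + 3 * (s * |s|) * x + 3 * |s| * x ^ 2 + |x| ^ 3 := by
  rcases abs_cases s with ⟨h1, h1'⟩ | ⟨h1, h1'⟩ <;> rcases abs_cases x with ⟨h2, h2'⟩ | ⟨h2, h2'⟩ <;>
    rcases abs_cases (s + x) with ⟨h3, h3'⟩ | ⟨h3, h3'⟩ <;> rw [h1, h2, h3] <;>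
    nlinarith [pow_nonneg (abs_nonneg s) 3, pow_nonneg (abs_nonneg x) 3, sq_nonneg s, sq_nonneg x,
      mul_nonneg (abs_nonneg s) (sq_nonneg x), pow_nonneg (abs_nonneg (s + x)) 3,
      mul_nonneg (abs_nonneg s) (sq_nonneg (s + x)), mul_nonneg (sq_nonneg s) (abs_nonneg (s + x))]

/-- The first term suffices for `|s| ≤ K`, the second for `|s| ≥ K`. This trades second moments for
first and third ones. -/
theorem sq_le_mul_abs_add (s : ℝ) {K : ℝ} (hK : 0 < K) : s ^ 2 ≤ K * |s| + |s| ^ 3 / K := by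
  rw [← sq_abs]
  have hs := abs_nonneg s
  set t := |s|
  rw [← sub_nonneg]
  have : K * t + t ^ 3 / K - t ^ 2 = t * ((t - K / 2) ^ 2 + 3 / 4 * K ^ 2) / K := by
    field_simp
    ring
  rw [this]
  positivity

section Moments

variable {Ω : Type*} [MeasurableSpace Ω] {P : Measure Ω} {ε : ℕ → Ω → ℝ}

theorem memLp_sum_mul {p : ENNReal} (hε : ∀ i, MemLp (ε i) p P) (h : ℕ → ℝ) (n : ℕ) :
    MemLp (fun ω => ∑ i ∈ Finset.range n, h i * ε i ω) p P :=
  memLp_finsetSum _ fun i _ => (hε i).const_mul (h i)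

theorem indepFun_sum_mul (hmeas : ∀ i, Measurable (ε i)) (hind : iIndepFun ε P) (h : ℕ → ℝ)
    (n : ℕ) : IndepFun (fun ω => ∑ i ∈ Finset.range n, h i * ε i ω) (fun ω => h n * ε n ω) P := by
  have h1 : iIndepFun (fun i ω => h i * ε i ω) P :=
    hind.comp (fun i x => h i * x) fun i => measurable_const_mul _
  have h2 := h1.indepFun_finsetSum_of_notMem (fun i => (hmeas i).const_mul _)
    (Finset.notMem_range_self (n := n))
  convert h2 using 1
  ext ω
  simp

theorem integral_sum_mul_sq (hmeas : ∀ i, Measurable (ε i)) (hε : ∀ i, MemLp (ε i) 2 P)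
    (hind : iIndepFun ε P) (hmean : ∀ i, ∫ ω, ε i ω ∂P = 0) (hvar : ∀ i, ∫ ω, ε i ω ^ 2 ∂P = 1)
    (h : ℕ → ℝ) (n : ℕ) :
    ∫ ω, (∑ i ∈ Finset.range n, h i * ε i ω) ^ 2 ∂P = ∑ i ∈ Finset.range n, h i ^ 2 := by
  induction n with
  | zero => simp
  | succ n ih =>
    have hS := memLp_sum_mul hε h n
    have hX := (hε n).const_mul (h n)
    have e1 := (indepFun_sum_mul hmeas hind h n).integral_fun_mul_eq_mul_integral hS.1 hX.1
    rw [integral_const_mul, hmean, mul_zero, mul_zero] at e1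
    have e2 : ∫ ω, (h n * ε n ω) ^ 2 ∂P = h n ^ 2 := by
      simp only [mul_pow]
      rw [integral_const_mul, hvar, mul_one]
    have n1 : Integrable (fun ω => (∑ i ∈ Finset.range n, h i * ε i ω) * (h n * ε n ω)) P :=
      hS.integrable_mul hX
    have n2 : Integrable (fun ω => (∑ i ∈ Finset.range n, h i * ε i ω) ^ 2 +
        2 * ((∑ i ∈ Finset.range n, h i * ε i ω) * (h n * ε n ω))) P :=
      hS.integrable_sq.add (n1.const_mul 2)
    simp only [Finset.sum_range_succ, add_sq, mul_assoc (2 : ℝ)]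
    rw [integral_add n2 hX.integrable_sq,
      integral_add hS.integrable_sq (n1.const_mul 2), integral_const_mul, e1, e2, ih]
    ring

variable [IsProbabilityMeasure P]

/-- Adding an independent centred variable increases the third absolute moment by at most
`3 E|S| E X² + E|X|³`. -/
theorem integral_abs_add_pow_three_le {S X : Ω → ℝ} (hS : MemLp S 3 P) (hX : MemLp X 3 P)
    (hind : IndepFun S X P) (hmean : ∫ ω, X ω ∂P = 0) :
    ∫ ω, |S ω + X ω| ^ 3 ∂P ≤ ∫ ω, |S ω| ^ 3 ∂P +
      3 * (∫ ω, |S ω| ∂P) * (∫ ω, X ω ^ 2 ∂P) + ∫ ω, |X ω| ^ 3 ∂P := by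
  have hcube : ∀ {Y : Ω → ℝ}, MemLp Y 3 P → Integrable (fun ω => |Y ω| ^ 3) P := fun hY => by
    simpa using hY.integrable_norm_pow (p := 3) (by norm_num)
  have hS2 : MemLp S 2 P := hS.mono_exponent (by norm_num)
  have hX2 : MemLp X 2 P := hX.mono_exponent (by norm_num)
  have hS1 : Integrable S P := hS.integrable (by norm_num)
  have hX1 : Integrable X P := hX.integrable (by norm_num)
  have m1 : Measurable fun s : ℝ => s * |s| := by fun_prop
  have m2 : Measurable fun s : ℝ => |s| := by fun_prop
  have m3 : Measurable fun s : ℝ => s ^ 2 := by fun_prop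
  have i1 : IndepFun (fun ω => S ω * |S ω|) X P := hind.comp m1 measurable_id
  have i2 : IndepFun (fun ω => |S ω|) (fun ω => X ω ^ 2) P := hind.comp m2 m3
  have n1 : Integrable (fun ω => S ω * |S ω|) P := hS2.integrable_mul hS2.abs
  have n2 : Integrable (fun ω => S ω * |S ω| * X ω) P := i1.integrable_mul n1 hX1
  have n3 : Integrable (fun ω => |S ω| * X ω ^ 2) P := i2.integrable_mul hS1.abs hX2.integrable_sq
  have e1 : ∫ ω, S ω * |S ω| * X ω ∂P = 0 := by
    rw [i1.integral_fun_mul_eq_mul_integral n1.1 hX1.1, hmean, mul_zero]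
  have e2 : ∫ ω, |S ω| * X ω ^ 2 ∂P = (∫ ω, |S ω| ∂P) * ∫ ω, X ω ^ 2 ∂P :=
    i2.integral_fun_mul_eq_mul_integral hS1.abs.1 hX2.integrable_sq.1
  have n4 : Integrable (fun ω => |S ω| ^ 3 + 3 * (S ω * |S ω| * X ω)) P :=
    (hcube hS).add (n2.const_mul 3)
  have n5 : Integrable (fun ω => |S ω| ^ 3 + 3 * (S ω * |S ω| * X ω) + 3 * (|S ω| * X ω ^ 2)) P :=
    n4.add (n3.const_mul 3)
  have hSX : MemLp (fun ω => S ω + X ω) 3 P := hS.add hX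
  have key : ∫ ω, |S ω + X ω| ^ 3 ∂P ≤
      ∫ ω, (|S ω| ^ 3 + 3 * (S ω * |S ω| * X ω) + 3 * (|S ω| * X ω ^ 2) + |X ω| ^ 3) ∂P := by
    refine integral_mono (hcube hSX) (n5.add (hcube hX)) fun ω => ?_
    refine (abs_add_pow_three_le (S ω) (X ω)).trans (le_of_eq ?_)
    ring
  rw [integral_add n5 (hcube hX), integral_add n4 (n3.const_mul 3),
    integral_add (hcube hS) (n2.const_mul 3), integral_const_mul, integral_const_mul, e1, e2] at key
  linarith

theorem integral_abs_le_one {S : Ω → ℝ} (hS : MemLp S 2 P) (h : ∫ ω, S ω ^ 2 ∂P ≤ 1) :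
    ∫ ω, |S ω| ∂P ≤ 1 := by
  have h1 : ∫ ω, |S ω| ∂P ≤ ∫ ω, (S ω ^ 2 + 1) / 2 ∂P := by
    refine integral_mono (hS.integrable (by norm_num)).abs
      ((hS.integrable_sq.add (integrable_const 1)).div_const 2) fun ω => ?_
    change |S ω| ≤ (S ω ^ 2 + 1) / 2
    nlinarith [sq_nonneg (|S ω| - 1), sq_abs (S ω)]
  rw [integral_div, integral_add hS.integrable_sq (integrable_const 1)] at h1
  simp at h1
  linarith

/-- Each summand adds at most `3 * h n ^ 2 + M * h n ^ 2`, since `E|S| ≤ 1` and `|h n| ^ 3 ≤ h n ^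
2`. -/
theorem integral_abs_sum_mul_pow_three_le (hmeas : ∀ i, Measurable (ε i))
    (hε : ∀ i, MemLp (ε i) 3 P) (hind : iIndepFun ε P) (hmean : ∀ i, ∫ ω, ε i ω ∂P = 0)
    (hvar : ∀ i, ∫ ω, ε i ω ^ 2 ∂P = 1) {M : ℝ} (hM : ∀ i, ∫ ω, |ε i ω| ^ 3 ∂P ≤ M) (h : ℕ → ℝ)
    (n : ℕ) (hle : ∑ i ∈ Finset.range n, h i ^ 2 ≤ 1) :
    ∫ ω, |∑ i ∈ Finset.range n, h i * ε i ω| ^ 3 ∂P ≤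
      (3 + M) * ∑ i ∈ Finset.range n, h i ^ 2 := by
  have hε2 : ∀ i, MemLp (ε i) 2 P := fun i => (hε i).mono_exponent (by norm_num)
  have hM0 : 0 ≤ M := (integral_nonneg fun ω => by positivity).trans (hM 0)
  induction n with
  | zero => simp
  | succ n ih =>
    rw [Finset.sum_range_succ] at hle
    have hpos : 0 ≤ ∑ i ∈ Finset.range n, h i ^ 2 := Finset.sum_nonneg fun i _ => sq_nonneg _
    have hle' : ∑ i ∈ Finset.range n, h i ^ 2 ≤ 1 := by nlinarith [sq_nonneg (h n)]
    have hn : |h n| ≤ 1 := by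
      rw [← sq_le_one_iff_abs_le_one]; linarith
    have e0 := integral_abs_add_pow_three_le (memLp_sum_mul hε h n) ((hε n).const_mul (h n))
      (indepFun_sum_mul hmeas hind h n) (by rw [integral_const_mul, hmean, mul_zero])
    have e1 : ∫ ω, |∑ i ∈ Finset.range n, h i * ε i ω| ∂P ≤ 1 :=
      integral_abs_le_one (memLp_sum_mul hε2 h n)
        (by rwa [integral_sum_mul_sq hmeas hε2 hind hmean hvar])
    have e2 : ∫ ω, (h n * ε n ω) ^ 2 ∂P = h n ^ 2 := by
      simp only [mul_pow]
      rw [integral_const_mul, hvar, mul_one]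
    have e3 : ∫ ω, |h n * ε n ω| ^ 3 ∂P ≤ h n ^ 2 * M := by
      simp only [abs_mul, mul_pow]
      rw [integral_const_mul]
      have : |h n| ^ 3 ≤ h n ^ 2 := by
        rw [← sq_abs]; exact pow_le_pow_of_le_one (abs_nonneg _) hn (by norm_num)
      exact mul_le_mul this (hM n) (integral_nonneg fun ω => by positivity) (sq_nonneg _)
    rw [e2] at e0
    simp only [Finset.sum_range_succ]
    nlinarith [ih hle', mul_le_mul_of_nonneg_right e1 (sq_nonneg (h n))]

end Moments

/-! ### The gain operator, the lower `L¹` bound and absence of arbitrage -/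

section Gain

variable {Ω : Type*} [MeasurableSpace Ω] {P : Measure Ω} {ε : ℕ → Ω → ℝ}

theorem coeFn_sum_smul (hε : ∀ i, MemLp (ε i) 2 P) (h : ℕ → ℝ) (n : ℕ) :
    ⇑(∑ i ∈ Finset.range n, h i • (hε i).toLp (ε i)) =ᵐ[P]
      fun ω => ∑ i ∈ Finset.range n, h i * ε i ω := by
  induction n with
  | zero =>
    simp only [Finset.range_zero, Finset.sum_empty]
    exact Lp.coeFn_zero ℝ 2 P
  | succ n ih =>
    simp only [Finset.sum_range_succ]
    filter_upwards [Lp.coeFn_add (∑ i ∈ Finset.range n, h i • (hε i).toLp (ε i))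
      (h n • (hε n).toLp (ε n)), Lp.coeFn_smul (h n) ((hε n).toLp (ε n)), (hε n).coeFn_toLp, ih]
      with ω h1 h2 h3 h4
    rw [h1, Pi.add_apply, h2, Pi.smul_apply, h3, h4, smul_eq_mul]

theorem orthonormal_toLp (hε : ∀ i, MemLp (ε i) 2 P) (hind : iIndepFun ε P)
    (hmean : ∀ i, ∫ ω, ε i ω ∂P = 0) (hvar : ∀ i, ∫ ω, ε i ω ^ 2 ∂P = 1) :
    Orthonormal ℝ (fun i => (hε i).toLp (ε i)) := by
  rw [orthonormal_iff_ite]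
  intro i j
  have hinner : inner ℝ ((hε i).toLp (ε i)) ((hε j).toLp (ε j)) = ∫ ω, ε i ω * ε j ω ∂P := by
    rw [L2.inner_def]
    refine integral_congr_ae ?_
    filter_upwards [(hε i).coeFn_toLp, (hε j).coeFn_toLp] with ω h1 h2
    rw [h1, h2]
    simp [mul_comm]
  rw [hinner]
  split_ifs with hij
  · subst hij
    simpa [sq] using hvar i
  · rw [(hind.indepFun hij).integral_fun_mul_eq_mul_integral (hε i).1 (hε j).1, hmean i, zero_mul]

/-- The isometry `h ↦ ∑ i, h i * e i` of an orthonormal sequence in `L²(P)`. -/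
noncomputable def noise {e : ℕ → Lp ℝ 2 P} (he : Orthonormal ℝ e) : EllTwo →ₗᵢ[ℝ] Lp ℝ 2 P :=
  he.orthogonalFamily.linearIsometry

theorem hasSum_noise {e : ℕ → Lp ℝ 2 P} (he : Orthonormal ℝ e) (h : EllTwo) :
    HasSum (fun i => h i • e i) (noise he h) :=
  he.orthogonalFamily.hasSum_linearIsometry h

/-- An event that depends on `ε 0, …, ε (N - 1)` is independent of `ε i` for `N ≤ i`. -/
theorem setIntegral_of_indep (hmeas : ∀ i, Measurable (ε i)) (hε : ∀ i, MemLp (ε i) 2 P)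
    (hind : iIndepFun ε P) {T : ℕ → Set ℝ} (hT : ∀ j, MeasurableSet (T j)) {N i : ℕ} (hi : N ≤ i) :
    ∫ ω in ⋂ j ∈ Finset.range N, ε j ⁻¹' T j, ε i ω ∂P =
      P.real (⋂ j ∈ Finset.range N, ε j ⁻¹' T j) * ∫ ω, ε i ω ∂P := by
  have hA : MeasurableSet (⋂ j ∈ Finset.range N, ε j ⁻¹' T j) :=
    Finset.measurableSet_biInter _ fun j _ => hmeas j (hT j)
  set A := ⋂ j ∈ Finset.range N, ε j ⁻¹' T j with hAdef
  have hd : Disjoint (Finset.range N) {i} := by simpa using hi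
  have h1 := hind.indepFun_finset _ _ hd hmeas
  have hD : MeasurableSet {x : Finset.range N → ℝ | ∀ j : Finset.range N, x j ∈ T j} := by
    rw [Set.ofPred_forall]
    exact MeasurableSet.iInter fun j => measurable_pi_apply j (hT (j : ℕ))
  -- The indicator of `A` is a measurable function of the first `N` coordinates.
  have h2 : IndepFun (A.indicator 1 : Ω → ℝ) (ε i) P := by
    have hψ : Measurable fun x : ({i} : Finset ℕ) → ℝ => x ⟨i, Finset.mem_singleton_self i⟩ :=
      measurable_pi_apply _
    have hφ : Measurable
        ({x : Finset.range N → ℝ | ∀ j : Finset.range N, x j ∈ T j}.indicator fun _ => (1 : ℝ)) :=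
      measurable_const.indicator hD
    have h3 := h1.comp hφ hψ
    have hmem : ∀ ω, ω ∈ A ↔ ∀ j < N, ε j ω ∈ T j := fun ω => by simp [hAdef]
    convert h3 using 1
    · ext ω
      by_cases hω : ω ∈ A
      · have h : (fun j : Finset.range N => ε j ω) ∈
            {x : Finset.range N → ℝ | ∀ j : Finset.range N, x j ∈ T j} :=
          fun j => (hmem ω).1 hω j (Finset.mem_range.1 j.2)
        exact (Set.indicator_of_mem hω _).trans (Set.indicator_of_mem h fun _ => (1 : ℝ)).symm
      · have h : (fun j : Finset.range N => ε j ω) ∉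
            {x : Finset.range N → ℝ | ∀ j : Finset.range N, x j ∈ T j} :=
          fun h => hω ((hmem ω).2 fun j hj => h ⟨j, Finset.mem_range.2 hj⟩)
        exact (Set.indicator_of_notMem hω _).trans (Set.indicator_of_notMem h fun _ => (1 : ℝ)).symm
    · rfl
  have h4 := h2.integral_fun_mul_eq_mul_integral
    ((measurable_const.indicator hA).aestronglyMeasurable) (hε i).1
  rw [integral_indicator_one hA] at h4
  rw [← h4, ← integral_indicator hA]
  congr 1 with ω
  by_cases h : ω ∈ A <;> simp [h]

variable [IsProbabilityMeasure P]

/-- The gain `h ↦ ∑ i, h i * (e i - b i)` as a continuous linear map. -/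
noncomputable def gainCLM {e : ℕ → Lp ℝ 2 P} (he : Orthonormal ℝ e) (b : EllTwo) :
    EllTwo →L[ℝ] Lp ℝ 2 P :=
  (noise he).toContinuousLinearMap - (Lp.constL 2 P ℝ).comp (innerSL ℝ b)

theorem gainCLM_apply {e : ℕ → Lp ℝ 2 P} (he : Orthonormal ℝ e) (b h : EllTwo) :
    gainCLM he b h = noise he h - Lp.const 2 P (inner ℝ b h) := rfl

theorem tendsto_finiteGain (hε : ∀ i, MemLp (ε i) 2 P)
    (he : Orthonormal ℝ fun i => (hε i).toLp (ε i)) (b h : EllTwo) :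
    Tendsto (finiteGain P hε b h) atTop (𝓝 (gainCLM he b h)) := by
  have h2 : HasSum (fun i => h i • b i) (inner ℝ b h) := by
    simpa [mul_comm] using lp.hasSum_inner (𝕜 := ℝ) b h
  have h3 : HasSum (fun i => h i • (Lp.const 2 P (b i) : Lp ℝ 2 P))
      (Lp.const 2 P (inner ℝ b h)) := by
    refine ((Lp.constL 2 P ℝ (E := ℝ)).hasSum h2).congr_fun fun i => ?_
    rw [map_smul]
    rfl
  rw [gainCLM_apply]
  refine ((hasSum_noise he h).sub h3).tendsto_sum_nat.congr fun n => ?_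
  simp only [finiteGain, smul_sub]

theorem setIntegral_const_lp (c : ℝ) (A : Set Ω) :
    ∫ ω in A, (Lp.const 2 P c : Lp ℝ 2 P) ω ∂P = P.real A * c := by
  rw [integral_congr_ae (ae_restrict_of_ae (Lp.coeFn_const 2 P c))]
  simp

/-- In this form continuity of the `L¹` norm on `L²` follows from continuity of the lattice
operations. -/
theorem integral_abs_lp (X : Lp ℝ 2 P) :
    ∫ ω, |X ω| ∂P =
      inner ℝ (indicatorConstLp 2 MeasurableSet.univ (measure_ne_top P _) (1 : ℝ)) |X| := by
  rw [L2.inner_indicatorConstLp_one, setIntegral_univ]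
  exact integral_congr_ae (Lp.coeFn_abs X).symm

theorem continuous_integral_abs : Continuous fun X : Lp ℝ 2 P => ∫ ω, |X ω| ∂P := by
  simp only [integral_abs_lp]
  exact continuous_const.inner (continuous_id.sup continuous_neg)

theorem integral_abs_lp_le_norm (X : Lp ℝ 2 P) : ∫ ω, |X ω| ∂P ≤ ‖X‖ := by
  rw [integral_abs_lp]
  refine (real_inner_le_norm _ _).trans ?_
  rw [norm_indicatorConstLp_one, norm_abs_eq_norm]
  simp

/-- A Khinchine type inequality: the `L¹` norm of a normalized sum is bounded from below. -/
theorem integral_abs_noise_ge (hmeas : ∀ i, Measurable (ε i)) (hε : ∀ i, MemLp (ε i) 2 P)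
    (hε3 : ∀ i, MemLp (ε i) 3 P) (hind : iIndepFun ε P) (hmean : ∀ i, ∫ ω, ε i ω ∂P = 0)
    (hvar : ∀ i, ∫ ω, ε i ω ^ 2 ∂P = 1) {M : ℝ} (hM : ∀ i, ∫ ω, |ε i ω| ^ 3 ∂P ≤ M)
    (he : Orthonormal ℝ fun i => (hε i).toLp (ε i)) {g : EllTwo} (hg : ‖g‖ = 1) :
    1 ≤ 4 * (3 + M) * ∫ ω, |noise he g ω| ∂P := by
  have hM0 : 0 ≤ M := (integral_nonneg fun ω => by positivity).trans (hM 0)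
  have hsum : HasSum (fun i => g i ^ 2) 1 := by
    have := lp.hasSum_inner (𝕜 := ℝ) g g
    rw [real_inner_self_eq_norm_sq, hg] at this
    simpa [sq] using this
  have key : ∀ n, ∑ i ∈ Finset.range n, g i ^ 2 ≤ 2 * (3 + M) *
      ∫ ω, |(∑ i ∈ Finset.range n, g i • (hε i).toLp (ε i) : Lp ℝ 2 P) ω| ∂P + 1 / 2 := by
    intro n
    have hle : ∑ i ∈ Finset.range n, g i ^ 2 ≤ 1 := sum_le_hasSum _ (fun i _ => sq_nonneg _) hsum
    have h3 := integral_abs_sum_mul_pow_three_le hmeas hε3 hind hmean hvar hM g n hle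
    have hS2 := memLp_sum_mul hε g n
    have hS3 := memLp_sum_mul hε3 g n
    have n3 : Integrable (fun ω => |∑ i ∈ Finset.range n, g i * ε i ω| ^ 3) P := by
      simpa using hS3.integrable_norm_pow (p := 3) (by norm_num)
    have n1 : Integrable (fun ω => |∑ i ∈ Finset.range n, g i * ε i ω|) P :=
      (hS2.integrable (by norm_num)).abs
    -- With `K = 2 * (3 + M)` the cubic term of `sq_le_mul_abs_add` contributes at most `1 / 2`.
    have hK : 0 < 2 * (3 + M) := by positivity
    have h1 := integral_mono hS2.integrable_sq
      ((n1.const_mul (2 * (3 + M))).add (n3.div_const (2 * (3 + M))))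
      fun ω => sq_le_mul_abs_add _ hK
    simp only [Pi.add_apply] at h1
    rw [integral_sum_mul_sq hmeas hε hind hmean hvar,
      integral_add (n1.const_mul (2 * (3 + M))) (n3.div_const (2 * (3 + M))), integral_const_mul,
      integral_div] at h1
    have e : ∫ ω, |(∑ i ∈ Finset.range n, g i • (hε i).toLp (ε i) : Lp ℝ 2 P) ω| ∂P =
        ∫ ω, |∑ i ∈ Finset.range n, g i * ε i ω| ∂P :=
      integral_congr_ae ((coeFn_sum_smul hε g n).fun_comp abs)
    rw [e]
    refine h1.trans (add_le_add le_rfl ?_)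
    rw [div_le_iff₀ hK]
    nlinarith
  have hlim := ((continuous_integral_abs (P := P)).tendsto _).comp
    (hasSum_noise he g).tendsto_sum_nat
  have := le_of_tendsto_of_tendsto' hsum.tendsto_sum_nat
    ((hlim.const_mul (2 * (3 + M))).add_const (1 / 2)) key
  linarith

/-- Independence written with inner products, so that it survives `L²` limits of sums over `i`. -/
theorem inner_indicator_sub_const (hmeas : ∀ i, Measurable (ε i)) (hε : ∀ i, MemLp (ε i) 2 P)
    (hind : iIndepFun ε P) (b : ℕ → ℝ) {T : ℕ → Set ℝ} (hT : ∀ j, MeasurableSet (T j)) {N i : ℕ}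
    (hi : N ≤ i) (hA : MeasurableSet (⋂ j ∈ Finset.range N, ε j ⁻¹' T j)) :
    inner ℝ (indicatorConstLp 2 hA (measure_ne_top P _) (1 : ℝ))
        ((hε i).toLp (ε i) - Lp.const 2 P (b i)) =
      P.real (⋂ j ∈ Finset.range N, ε j ⁻¹' T j) *
        inner ℝ (indicatorConstLp 2 MeasurableSet.univ (measure_ne_top P _) (1 : ℝ))
          ((hε i).toLp (ε i) - Lp.const 2 P (b i)) := by
  simp only [inner_sub_right, L2.inner_indicatorConstLp_one, setIntegral_const_lp]
  rw [integral_congr_ae (ae_restrict_of_ae (hε i).coeFn_toLp), setIntegral_univ,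
    integral_congr_ae (hε i).coeFn_toLp, setIntegral_of_indep hmeas hε hind hT hi]
  simp
  ring

/-- If each single asset is free of arbitrage, then so is the market. -/
theorem eq_zero_of_gain_nonneg (hmeas : ∀ i, Measurable (ε i)) (hε : ∀ i, MemLp (ε i) 2 P)
    (hind : iIndepFun ε P) {b h : ℕ → ℝ}
    (hNA : ∀ i, 0 < P {ω | b i < ε i ω} ∧ 0 < P {ω | ε i ω < b i}) {G : Lp ℝ 2 P}
    (hG : Tendsto (finiteGain P hε b h) atTop (𝓝 G)) (hG0 : 0 ≤ G) : h = 0 := by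
  by_contra hne
  obtain ⟨k, hk⟩ := Function.ne_iff.1 hne
  have hneg : 0 < P {ω | h k * (ε k ω - b k) < 0} := by
    rcases lt_or_gt_of_ne hk with hk | hk
    · refine (hNA k).1.trans_le (measure_mono fun ω hω => ?_)
      exact mul_neg_of_neg_of_pos hk (sub_pos.2 hω)
    · refine (hNA k).2.trans_le (measure_mono fun ω hω => ?_)
      exact mul_neg_of_pos_of_neg hk (sub_neg.2 hω)
  obtain ⟨m, hm⟩ : ∃ m : ℕ, 0 < P {ω | h k * (ε k ω - b k) ≤ -(1 / ((m : ℝ) + 1))} := by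
    by_contra! hcon
    refine hneg.ne' (measure_mono_null (fun ω (hω : h k * (ε k ω - b k) < 0) => ?_)
      (measure_iUnion_null fun m => nonpos_iff_eq_zero.1 (hcon m)))
    obtain ⟨m, hm⟩ := exists_nat_one_div_lt (neg_pos.2 hω)
    have hle : h k * (ε k ω - b k) ≤ -(1 / ((m : ℝ) + 1)) := by linarith
    exact Set.mem_iUnion.2 ⟨m, hle⟩
  set c : ℝ := 1 / ((m : ℝ) + 1)
  have hc : 0 < c := by positivity
  -- Asset `k` loses at least `c` and no other asset gains; by independence finitely many of these
  -- events occur together with positive probability.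
  let T : ℕ → Set ℝ := fun j => {x | h j * (x - b j) ≤ if j = k then -c else 0}
  have hT : ∀ j, MeasurableSet (T j) := fun j =>
    measurableSet_le (by fun_prop) measurable_const
  have hTpos : ∀ j, P (ε j ⁻¹' T j) ≠ 0 := by
    intro j
    by_cases hj : j = k
    · subst hj
      simpa [T] using hm.ne'
    · rcases le_total (h j) 0 with h0 | h0
      · refine ((hNA j).1.trans_le (measure_mono fun ω (hω : b j < ε j ω) => ?_)).ne'
        simpa [T, hj] using mul_nonpos_of_nonpos_of_nonneg h0 (sub_nonneg.2 hω.le)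
      · refine ((hNA j).2.trans_le (measure_mono fun ω (hω : ε j ω < b j) => ?_)).ne'
        simpa [T, hj] using mul_nonpos_of_nonneg_of_nonpos h0 (sub_nonpos.2 hω.le)
  -- On the event the first `N` assets lose at least `c`, so `G ≥ 0` forces the tail to be at least
  -- `c` there. Being uncorrelated with the event, the tail has mean at least `c`, however small the
  -- event; yet it tends to zero in `L²`.
  have key : ∀ N, k < N → c ≤ ‖G - finiteGain P hε b h N‖ := by
    intro N hN
    have hA : MeasurableSet (⋂ j ∈ Finset.range N, ε j ⁻¹' T j) :=
      Finset.measurableSet_biInter _ fun j _ => hmeas j (hT j)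
    have hPA : 0 < P.real (⋂ j ∈ Finset.range N, ε j ⁻¹' T j) := by
      rw [measureReal_def, hind.measure_inter_preimage_eq_mul _ fun j _ => hT j]
      refine ENNReal.toReal_pos (Finset.prod_ne_zero_iff.2 fun j _ => hTpos j) ?_
      exact ENNReal.prod_ne_top fun j _ => measure_ne_top _ _
    have hinner := fun (i : ℕ) (hi : N ≤ i) => inner_indicator_sub_const hmeas hε hind b hT hi hA
    have hmemA : ∀ ω ∈ ⋂ j ∈ Finset.range N, ε j ⁻¹' T j,
        ∑ i ∈ Finset.range N, h i * (ε i ω - b i) ≤ -c := by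
      intro ω hω
      have h1 : ∀ j ∈ Finset.range N, h j * (ε j ω - b j) ≤ if j = k then -c else 0 :=
        fun j hj => Set.mem_iInter₂.1 hω j hj
      refine (Finset.sum_le_sum h1).trans (le_of_eq ?_)
      simp [hN]
    set A := ⋂ j ∈ Finset.range N, ε j ⁻¹' T j
    set a := indicatorConstLp 2 hA (measure_ne_top P _) (1 : ℝ)
    set u := indicatorConstLp 2 MeasurableSet.univ (measure_ne_top P _) (1 : ℝ)
    have hlim : ∀ v : Lp ℝ 2 P, Tendsto (fun n => inner ℝ v
        (finiteGain P hε b h n - finiteGain P hε b h N)) atTop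
        (𝓝 (inner ℝ v (G - finiteGain P hε b h N))) := fun v =>
      tendsto_const_nhds.inner (hG.sub_const _)
    have heq : inner ℝ a (G - finiteGain P hε b h N) =
        P.real A * inner ℝ u (G - finiteGain P hε b h N) := by
      refine tendsto_nhds_unique (hlim a) (((hlim u).const_mul _).congr' ?_)
      filter_upwards [eventually_ge_atTop N] with n hn
      simp only [finiteGain]
      rw [← Finset.sum_Ico_eq_sub _ hn, inner_sum, inner_sum, Finset.mul_sum]
      refine Finset.sum_congr rfl fun i hi => ?_
      rw [inner_smul_right, inner_smul_right, hinner i (Finset.mem_Ico.1 hi).1]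
      ring
    have hu : inner ℝ u (G - finiteGain P hε b h N) ≤ ‖G - finiteGain P hε b h N‖ := by
      refine (real_inner_le_norm _ _).trans ?_
      rw [norm_indicatorConstLp_one]
      simp
    have hfin : ⇑(finiteGain P hε b h N) =ᵐ[P]
        fun ω => ∑ i ∈ Finset.range N, h i * (ε i ω - b i) := by
      -- `finiteGain` unfolds to the weighted sum of the classes of `ε i - b i`, so `coeFn_sum_smul`
      -- applies to the shifted variables.
      have h0 : ∀ i, MemLp (fun ω => ε i ω - b i) 2 P := fun i => (hε i).sub (memLp_const _)
      exact coeFn_sum_smul h0 h N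
    have hlow : P.real A * c ≤ inner ℝ a (G - finiteGain P hε b h N) := by
      rw [L2.inner_indicatorConstLp_one, ← smul_eq_mul, ← setIntegral_const]
      refine setIntegral_mono_on_ae (integrable_const c).integrableOn
        (integrable_lp_two P _).integrableOn hA ?_
      filter_upwards [Lp.coeFn_sub G (finiteGain P hε b h N), hfin, (Lp.coeFn_nonneg G).2 hG0]
        with ω h1 h2 h3 hω
      have h4 := hmemA ω hω
      rw [h1, Pi.sub_apply, h2]
      simp only [Pi.zero_apply] at h3
      linarith
    rw [heq] at hlow
    exact (le_of_mul_le_mul_left hlow hPA).trans hu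
  have h0 : Tendsto (fun N => ‖G - finiteGain P hε b h N‖) atTop (𝓝 0) := by
    simpa using (hG.const_sub G).norm
  obtain ⟨N, h1, h2⟩ := ((eventually_gt_atTop k).and (h0.eventually_lt_const hc)).exists
  exact absurd (key N h1) (not_le.2 h2)

end Gain

/-! ### Normalized gains -/

section Limit

variable {Ω : Type*} [MeasurableSpace Ω] {P : Measure Ω} {ε : ℕ → Ω → ℝ}

theorem measureReal_smul_lt {r : ℝ} (hr : 0 < r) (X Y : Lp ℝ 2 P) :
    P.real {ω | (r • X : Lp ℝ 2 P) ω < (r • Y : Lp ℝ 2 P) ω} = P.real {ω | X ω < Y ω} := by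
  refine measureReal_congr ?_
  filter_upwards [Lp.coeFn_smul r X, Lp.coeFn_smul r Y] with ω h1 h2
  refine propext ?_
  change (r • X : Lp ℝ 2 P) ω < (r • Y : Lp ℝ 2 P) ω ↔ X ω < Y ω
  rw [h1, h2]
  simp [hr]

theorem memLp_three_of_iSup_lt_top (hmeas : ∀ i, Measurable (ε i))
    (hmom : (⨆ i, ∫⁻ ω, ‖ε i ω‖ₑ ^ 3 ∂P) < ⊤) (i : ℕ) : MemLp (ε i) 3 P := by
  refine ⟨(hmeas i).aestronglyMeasurable, ?_⟩
  rw [eLpNorm_lt_top_iff_lintegral_rpow_enorm_lt_top (by norm_num) (by norm_num)]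
  simpa using (le_iSup (fun i => ∫⁻ ω, ‖ε i ω‖ₑ ^ 3 ∂P) i).trans_lt hmom

theorem integral_abs_pow_three_le_iSup (hmeas : ∀ i, Measurable (ε i))
    (hmom : (⨆ i, ∫⁻ ω, ‖ε i ω‖ₑ ^ 3 ∂P) < ⊤) (i : ℕ) :
    ∫ ω, |ε i ω| ^ 3 ∂P ≤ (⨆ i, ∫⁻ ω, ‖ε i ω‖ₑ ^ 3 ∂P).toReal := by
  rw [integral_eq_lintegral_of_nonneg_ae (ae_of_all _ fun ω => by positivity)
    (by have := hmeas i; fun_prop)]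
  refine ENNReal.toReal_mono hmom.ne (le_trans (le_of_eq ?_)
    (le_iSup (fun i => ∫⁻ ω, ‖ε i ω‖ₑ ^ 3 ∂P) i))
  refine lintegral_congr fun ω => ?_
  rw [ENNReal.ofReal_pow (abs_nonneg _), Real.enorm_eq_ofReal_abs]

variable [IsProbabilityMeasure P]

theorem integral_noise (hε : ∀ i, MemLp (ε i) 2 P) (hmean : ∀ i, ∫ ω, ε i ω ∂P = 0)
    (he : Orthonormal ℝ fun i => (hε i).toLp (ε i)) (g : EllTwo) :
    ∫ ω, noise he g ω ∂P = 0 := by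
  rw [← setIntegral_univ,
    ← L2.inner_indicatorConstLp_one (𝕜 := ℝ) MeasurableSet.univ (measure_ne_top P _)]
  set u := indicatorConstLp 2 MeasurableSet.univ (measure_ne_top P _) (1 : ℝ) with hu
  have h1 := (innerSL ℝ u).hasSum (hasSum_noise he g)
  refine h1.unique ?_
  convert hasSum_zero with i
  rw [map_smul, innerSL_apply_apply, hu, L2.inner_indicatorConstLp_one, setIntegral_univ,
    integral_congr_ae (hε i).coeFn_toLp, hmean, smul_zero]

/-- A centred variable that is almost bounded from below by a small variable has small `L¹` norm. -/
theorem integral_abs_le_of_integral_eq_zero (Y D : Lp ℝ 2 P) (hY : ∫ ω, Y ω ∂P = 0) :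
    ∫ ω, |Y ω| ∂P ≤ 2 * ‖D‖ + 2 * (‖Y - D‖ * √(P.real {ω | Y ω < D ω})) := by
  have h1 := integral_abs_le P (Y - D)
  rw [measureReal_sub_neg] at h1
  have hYi := integrable_lp_two P Y
  have hDi := integrable_lp_two P D
  have h2 : ∫ ω, (Y - D : Lp ℝ 2 P) ω ∂P = -∫ ω, D ω ∂P := by
    rw [integral_congr_ae (Lp.coeFn_sub Y D), integral_sub' hYi hDi, hY, zero_sub]
  have h3 : ∫ ω, |Y ω| ∂P ≤ ∫ ω, |(Y - D : Lp ℝ 2 P) ω| ∂P + ∫ ω, |D ω| ∂P := by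
    rw [← integral_add (integrable_lp_two P _).abs hDi.abs]
    refine integral_mono_ae hYi.abs ((integrable_lp_two P _).abs.add hDi.abs) ?_
    filter_upwards [Lp.coeFn_sub Y D] with ω h
    rw [h, Pi.sub_apply]
    simpa using abs_add_le (Y ω - D ω) (D ω)
  have h4 := integral_abs_lp_le_norm D
  have h5 : -∫ ω, D ω ∂P ≤ ∫ ω, |D ω| ∂P :=
    (neg_le_abs _).trans (abs_integral_le_integral_abs)
  linarith

/-- In a market without arbitrage in the single assets and with bounded third moments, normalized
gains cannot dominate, with probability tending to one, claims that tend to zero. -/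
theorem not_tendsto_of_norm_eq_one (hmeas : ∀ i, Measurable (ε i)) (hε : ∀ i, MemLp (ε i) 2 P)
    (hε3 : ∀ i, MemLp (ε i) 3 P) (hind : iIndepFun ε P) (hmean : ∀ i, ∫ ω, ε i ω ∂P = 0)
    (hvar : ∀ i, ∫ ω, ε i ω ^ 2 ∂P = 1) {M : ℝ} (hM : ∀ i, ∫ ω, |ε i ω| ^ 3 ∂P ≤ M)
    (he : Orthonormal ℝ fun i => (hε i).toLp (ε i)) (b : EllTwo)
    (hNA : ∀ i, 0 < P {ω | b i < ε i ω} ∧ 0 < P {ω | ε i ω < b i})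
    {ι : Type*} (F : Ultrafilter ι) (g : ι → EllTwo) (hg : ∀ᶠ i in F, ‖g i‖ = 1)
    {B : ι → Lp ℝ 2 P} (hB : Tendsto B F (𝓝 0)) :
    ¬Tendsto (fun i => P.real {ω | gainCLM he b (g i) ω < B i ω}) F (𝓝 0) := by
  intro hP
  have hg1 : ∀ᶠ i in F, ‖g i‖ ≤ 1 := hg.mono fun i hi => hi.le
  obtain ⟨g₀, hw⟩ := exists_weak_limit F g hg1
  have h0 : (0 : Lp ℝ 2 P) ≤ gainCLM he b g₀ := le_of_weak_limit P _ hg1 hw hB hP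
  have hg0 : (g₀ : ℕ → ℝ) = 0 :=
    eq_zero_of_gain_nonneg hmeas hε hind hNA (tendsto_finiteGain hε he b g₀) h0
  have hg0' : g₀ = 0 := lp.ext hg0
  have hc : Tendsto (fun i => inner ℝ b (g i)) F (𝓝 0) := by
    simpa [hg0', real_inner_comm] using hw b
  -- Moving the drift to the other side turns a comparison of the gain with `B i` into one of the
  -- centred noise with `D i`.
  set D : ι → Lp ℝ 2 P := fun i => B i + Lp.const 2 P (inner ℝ b (g i))
  have hDlim : Tendsto D F (𝓝 0) := by
    have := hB.add (((Lp.constL 2 P ℝ (E := ℝ)).continuous.tendsto _).comp hc)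
    simpa using this
  have heq : ∀ i, P.real {ω | gainCLM he b (g i) ω < B i ω} =
      P.real {ω | noise he (g i) ω < D i ω} := fun i => by
    have h : gainCLM he b (g i) - B i = noise he (g i) - D i :=
      (sub_sub _ _ _).trans (congrArg _ (add_comm _ _))
    rw [← measureReal_sub_neg, ← measureReal_sub_neg, h]
  have hbound : Tendsto (fun i => 4 * (3 + M) * (2 * ‖D i‖ +
      2 * ((1 + ‖D i‖) * √(P.real {ω | gainCLM he b (g i) ω < B i ω})))) F (𝓝 0) := by
    have := ((hDlim.norm.const_mul 2).add (((hDlim.norm.const_add 1).mul hP.sqrt).const_mul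
      2)).const_mul (4 * (3 + M))
    simpa using this
  obtain ⟨i, hi, hi'⟩ := (hg.and (hbound.eventually_lt_const one_pos)).exists
  have hM0 : 0 ≤ M := (integral_nonneg fun ω => by positivity).trans (hM 0)
  refine absurd hi' (not_lt.2 ?_)
  refine (integral_abs_noise_ge hmeas hε hε3 hind hmean hvar hM he hi).trans ?_
  gcongr
  refine (integral_abs_le_of_integral_eq_zero _ (D i) (integral_noise hε hmean he _)).trans ?_
  rw [heq]
  gcongr
  refine (norm_sub_le _ _).trans (le_of_eq ?_)
  rw [LinearIsometry.norm_map, hi]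

theorem measureReal_const_add_lt (X B : Lp ℝ 2 P) (z η : ℝ) :
    P.real {ω | (Lp.const 2 P z + X : Lp ℝ 2 P) ω < B ω - η} =
      P.real {ω | X ω < (B - Lp.const 2 P z - Lp.const 2 P η : Lp ℝ 2 P) ω} := by
  refine measureReal_congr ?_
  filter_upwards [Lp.coeFn_add (Lp.const 2 P z) X, Lp.coeFn_const 2 P z, Lp.coeFn_const 2 P η,
    Lp.coeFn_sub (B - Lp.const 2 P z) (Lp.const 2 P η), Lp.coeFn_sub B (Lp.const 2 P z)]
    with ω h1 h2 h3 h4 h5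
  refine propext ?_
  change (Lp.const 2 P z + X : Lp ℝ 2 P) ω < B ω - η ↔
    X ω < (B - Lp.const 2 P z - Lp.const 2 P η : Lp ℝ 2 P) ω
  rw [h1, h4, Pi.add_apply, Pi.sub_apply, h5, Pi.sub_apply, h2, h3]
  simp only [Function.const_apply]
  constructor <;> intro h <;> linarith

end Limit

end LargeMarket

/-! ### The main argument -/

open LargeMarket in
theorem proposition1 {Ω : Type*} [MeasurableSpace Ω] (P : Measure Ω) [IsProbabilityMeasure P]
    (ε : ℕ → Ω → ℝ) (b : ℕ → ℝ)
    -- the noise: independent, square-integrable, centred, of unit variance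
    (hmeas : ∀ i, Measurable (ε i)) (hL2 : ∀ i, MemLp (ε i) 2 P) (hind : iIndepFun ε P)
    (hmean : ∀ i, ∫ ω, ε i ω ∂P = 0) (hvar : ∀ i, ∫ ω, ε i ω ^ 2 ∂P = 1)
    -- the vector `b` is square-summable
    (hb : Memℓp b 2)
    -- no arbitrage in each single asset
    (hNA : ∀ i, 0 < P {ω | b i < ε i ω} ∧ 0 < P {ω | ε i ω < b i})
    -- uniformly bounded third moments
    (hmom : (⨆ i, ∫⁻ ω, ‖ε i ω‖ₑ ^ 3 ∂P) < ⊤)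
    (z : ℝ) (B : Lp ℝ 2 P) (hB : B ∉ LargeMarket.attainableWithDisposal P hL2 b z) :
    ∃ η : ℝ, 0 < η ∧
      η < ⨅ h : LargeMarket.EllTwo,
        P.real {ω | LargeMarket.portfolioValue P hL2 b z h ω < B ω - η} := by
  by_contra! hcon
  have he := orthonormal_toLp hL2 hind hmean hvar
  let β : EllTwo := ⟨b, hb⟩
  let U := gainCLM he β
  have hV : ∀ h, portfolioValue P hL2 b z h = Lp.const 2 P z + U h := fun h => by
    rw [portfolioValue, tendsto_nhds_unique (tendsto_gain P hL2 hind hmean hvar hb h)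
      (tendsto_finiteGain hL2 he β h)]
  let η : ℕ → ℝ := fun n => 1 / ((n : ℝ) + 1)
  have hη : ∀ n, 0 < η n := fun n => by positivity
  let C : ℕ → Lp ℝ 2 P := fun n => B - Lp.const 2 P z - Lp.const 2 P (η n)
  -- The infimum is at most `η n` but need not be attained, hence the factor `2`.
  have hex : ∀ n, ∃ h, P.real {ω | U h ω < C n ω} < 2 * η n := fun n => by
    obtain ⟨h, hh⟩ := exists_lt_of_ciInf_lt
      ((hcon (η n) (hη n)).trans_lt (by linarith [hη n] : η n < 2 * η n))
    rw [hV, measureReal_const_add_lt] at hh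
    exact ⟨h, hh⟩
  choose h hh using hex
  -- An ultrafilter gives a clean dichotomy: if no bound holds eventually, every bound is eventually
  -- exceeded.
  let F : Ultrafilter ℕ := hyperfilter ℕ
  have hηlim : Tendsto η F (𝓝 0) :=
    tendsto_one_div_add_atTop_nhds_zero_nat.mono_left Nat.hyperfilter_le_atTop
  have hPlim : Tendsto (fun n => P.real {ω | U (h n) ω < C n ω}) F (𝓝 0) := by
    refine squeeze_zero (fun n => measureReal_nonneg) (fun n => (hh n).le) ?_
    simpa using hηlim.const_mul 2
  have hClim : Tendsto C F (𝓝 (B - Lp.const 2 P z)) := by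
    have := (((Lp.constL 2 P ℝ (E := ℝ)).continuous.tendsto _).comp hηlim).const_sub
      (B - Lp.const 2 P z)
    simpa using this
  by_cases hbdd : ∃ R : ℝ, ∀ᶠ n in F, ‖h n‖ ≤ R
  · obtain ⟨R, hR⟩ := hbdd
    obtain ⟨g, hg⟩ := exists_weak_limit F h hR
    have hle : B - Lp.const 2 P z ≤ U g := le_of_weak_limit P U hR hg hClim hPlim
    refine hB ⟨_, ⟨g, rfl⟩, portfolioValue P hL2 b z g - B, ?_, by abel⟩
    rw [hV, sub_nonneg]
    exact sub_le_iff_le_add'.1 hle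
  · have hlarge : ∀ R : ℝ, ∀ᶠ n in F, R < ‖h n‖ := fun R => by
      have := fun hR => hbdd ⟨R, hR⟩
      simpa only [not_le] using Ultrafilter.eventually_not.2 this
    have htop : Tendsto (fun n => ‖h n‖) F atTop :=
      tendsto_atTop.2 fun R => (hlarge R).mono fun n hn => hn.le
    refine not_tendsto_of_norm_eq_one hmeas hL2 (memLp_three_of_iSup_lt_top hmeas hmom) hind hmean
      hvar (integral_abs_pow_three_le_iSup hmeas hmom) he β hNA F (fun n => ‖h n‖⁻¹ • h n) ?_
      (B := fun n => ‖h n‖⁻¹ • C n) ?_ ?_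
    · filter_upwards [hlarge 0] with n hn
      rw [norm_smul, norm_inv, norm_norm, inv_mul_cancel₀ hn.ne']
    · simpa using htop.inv_tendsto_atTop.smul hClim
    -- Positive scaling does not change the event.
    · refine hPlim.congr' ?_
      filter_upwards [hlarge 0] with n hn
      rw [map_smul, measureReal_smul_lt (inv_pos.2 hn)]
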